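/- Let $V$, $W$ be finite-dimensional real vector spaces, $k=\dim V$, $n=\dim W$, and let $\Gamma=(\gamma_1,\dots,\gamma_m)$ in $V^*$ and $\mathrm A=(a_1,\dots,a_m)$ in $W^*$ be Gale dual vector configurations: $\Gamma$ spans $V^*$, $\mathrm A$ spans $W^*$, and the sequence $0\to W\to\mathbb R^m\to V^*\to 0$ with maps $w\mapsto(\langle a_1,w\rangle,\dots,\langle a_m,w\rangle)$ and $e_i\mapsto\gamma_i$ is exact. Let $b_1,\dots,b_m\in\mathbb R$ and let $$P=\{w\in W:\langle a_i,w\rangle+b_i\ge 0,\ i=1,\dots,m\}$$ be a generic polyhedron, that is, $P\neq\varnothing$ and for every $w\in P$ the family of those $a_i$ with $\langle a_i,w\rangle+b_i=0$ is linearly independent. Let $\mathcal K_P$ be the simplicial complex of all $I\subset\{1,\dots,m\}$ for which there is $w\in P$ with $\langle a_i,w\rangle+b_i=0$ for all $i\in I$ (the normal fan of $P$ then consists of the cones generated by $\{a_i:i\in I\}$, $I\in\mathcal K_P$). Put $$U(\mathcal K_P)=\mathbb R^m\setminus\bigcup_{I\notin\mathcal K_P}\{x: x_i=0\text{ for all }i\in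 I\},\qquad \mu_\Gamma(x)=\sum_{i=1}^m x_i^2\gamma_i\in V^*,\qquad \delta=\sum_{i=1}^m b_i\gamma_i,$$ and let $V$ act on $U(\mathcal K_P)$ by $v\cdot x=(e^{\langle\gamma_1,v\rangle}x_1,\dots,e^{\langle\gamma_m,v\rangle}x_m)$. Then: 1. $\delta$ lies in the relative interior of $\mathrm{cone}(\gamma_i:i\notin I)$ for every $I\in\mathcal K_P$; 2. $\mu_\Gamma^{-1}(\delta)\subset U(\mathcal K_P)$; 3. $\delta$ is a regular value of $\mu_\Gamma\colon\mathbb R^m\to V^*$; 4. the action of $V$ on $U(\mathcal K_P)$ is free and proper; the level set $\mu_\Gamma^{-1}(\delta)=\{x\in\mathbb R^m:\gamma_1x_1^2+\dots+\gamma_mx_m^2=\delta\}$ is a nondegenerate intersection of $k$ quadrics (writing the equation in coordinates with respect to any basis of $V^*$ dual to a basis of $V$, the gradients of the $k$ quadratic functions are linearly independent at each point of the level set); and the quotient $U(\mathcal K_P)/V$, with the $n$-dimensional smooth structure for which $U(\mathcal K_P)\to U(\mathcal K_P)/V$ is a smooth submersion, is diffeomorphic to $\mu_\Gamma^{-1}(\delta)$,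 with its structure of an embedded $n$-dimensional submanifold of $\mathbb R^m$. -/

import Mathlib

open scoped Manifold ContDiff

noncomputable section

namespace GaleQuadrics

/-! ### Gale duality, cones, polyhedra -/

/-- `a` (in `W^*`) and `γ` (in `V^*`) are Gale dual vector configurations: `γ` spans `V^*`, `a` spans
`W^*`, and the sequence `0 → W → ℝ^m → V^* → 0` with maps `w ↦ (⟨a_1, w⟩, …, ⟨a_m, w⟩)` and
`e_i ↦ γ_i` is exact. (Injectivity of the first map is `span_left`, surjectivity of the second one is
`span_right`.) -/
structure IsGaleDual {m : ℕ} {V W : Type*} [NormedAddCommGroup V] [NormedSpace ℝ V]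
    [AddCommGroup W] [Module ℝ W]
    (a : Fin m → Module.Dual ℝ W) (γ : Fin m → StrongDual ℝ V) : Prop where
  span_left : Submodule.span ℝ (Set.range a) = ⊤
  span_right : Submodule.span ℝ (Set.range γ) = ⊤
  exact : ∀ c : Fin m → ℝ, ∑ i, c i • γ i = 0 ↔ ∃ w : W, ∀ i, a i w = c i

/-- The cone generated by the vectors `γ_i`, `i ∉ I`. -/
def dualCone {m : ℕ} {E : Type*} [AddCommGroup E] [Module ℝ E]
    (γ : Fin m → E) (I : Finset (Fin m)) : Set E :=
  (PointedCone.hull ℝ (γ '' {i | i ∉ I}) : Set E)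

/-- The solution set of the inequalities `⟨a_i, w⟩ + b_i ≥ 0`, `i = 1, …, m`. -/
def polyhedron {m : ℕ} {W : Type*} [AddCommGroup W] [Module ℝ W]
    (a : Fin m → Module.Dual ℝ W) (b : Fin m → ℝ) : Set W :=
  {w | ∀ i, 0 ≤ a i w + b i}

/-- The inequalities `⟨a_i, w⟩ + b_i ≥ 0` define a generic polyhedron: it is nonempty, and at every
point of it the normals of the hyperplanes passing through that point are linearly independent
(as an indexed family). -/
def IsGenericPolyhedron {m : ℕ} {W : Type*} [AddCommGroup W] [Module ℝ W]
    (a : Fin m → Module.Dual ℝ W) (b : Fin m → ℝ) : Prop :=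
  (polyhedron a b).Nonempty ∧
    ∀ w ∈ polyhedron a b, LinearIndependent ℝ (fun i : {i : Fin m // a i w + b i = 0} => a i)

/-- The dual simplicial complex `K_P`: the sets `I` such that the face
`F_I = {w ∈ P : ⟨a_i, w⟩ + b_i = 0 for i ∈ I}` is nonempty. -/
def dualComplex {m : ℕ} {W : Type*} [AddCommGroup W] [Module ℝ W]
    (a : Fin m → Module.Dual ℝ W) (b : Fin m → ℝ) : Set (Finset (Fin m)) :=
  {I | {w ∈ polyhedron a b | ∀ i ∈ I, a i w + b i = 0}.Nonempty}

/-! ### The exponential action -/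

/-- The complement `U(K)` in `ℝ^m` of the union of the coordinate subspaces
`{x : x_i = 0 for i ∈ I}`, `I ∉ K`, as an open subset. -/
def coordComplement {m : ℕ} (K : Set (Finset (Fin m))) : TopologicalSpace.Opens (Fin m → ℝ) where
  carrier := (⋃ I ∈ Kᶜ, {x : Fin m → ℝ | ∀ i ∈ I, x i = 0})ᶜ
  is_open' := by
    rw [isOpen_compl_iff]
    refine (Set.toFinite _).isClosed_biUnion fun I _ => ?_
    simp only [Set.ofPred_forall]
    exact isClosed_biInter fun i _ => isClosed_eq (continuous_apply i) continuous_const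

/-- The exponential action on `ℝ^m`: `v · x = (x_1 e^{⟨γ_1, v⟩}, …, x_m e^{⟨γ_m, v⟩})`. -/
def expAct {m : ℕ} {V : Type*} [NormedAddCommGroup V] [NormedSpace ℝ V]
    (γ : Fin m → StrongDual ℝ V) (v : V) (x : Fin m → ℝ) : Fin m → ℝ :=
  fun i => x i * Real.exp (γ i v)

theorem expAct_mem {m : ℕ} {V : Type*} [NormedAddCommGroup V] [NormedSpace ℝ V]
    (γ : Fin m → StrongDual ℝ V) (K : Set (Finset (Fin m))) (v : V) (x : Fin m → ℝ)
    (hx : x ∈ coordComplement K) : expAct γ v x ∈ coordComplement K := by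
  change _ ∈ (⋃ I ∈ Kᶜ, {x : Fin m → ℝ | ∀ i ∈ I, x i = 0})ᶜ at hx ⊢
  simpa [expAct, Real.exp_ne_zero] using hx

/-- The action of the additive group `V` on `U(K)`, the restriction of the exponential action. -/
abbrev expAction {m : ℕ} {V : Type*} [NormedAddCommGroup V] [NormedSpace ℝ V]
    (γ : Fin m → StrongDual ℝ V) (K : Set (Finset (Fin m))) :
    AddAction V (coordComplement K) where
  vadd v x := ⟨expAct γ v x, expAct_mem γ K v x x.2⟩
  zero_vadd x := Subtype.ext (by funext i; change x.1 i * Real.exp (γ i 0) = x.1 i; simp)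
  add_vadd v w x := Subtype.ext (by
    funext i
    change x.1 i * Real.exp (γ i (v + w)) = x.1 i * Real.exp (γ i w) * Real.exp (γ i v)
    rw [map_add, add_comm, Real.exp_add, mul_assoc])

/-- The orbit space `U(K)/V` (with the quotient topology). -/
abbrev leafSpace {m : ℕ} {V : Type*} [NormedAddCommGroup V] [NormedSpace ℝ V]
    (γ : Fin m → StrongDual ℝ V) (K : Set (Finset (Fin m))) : Type :=
  Quotient (@AddAction.orbitRel V (coordComplement K) _ (expAction γ K))

/-- The quotient map `U(K) → U(K)/V`. -/
def leafMap {m : ℕ} {V : Type*} [NormedAddCommGroup V] [NormedSpace ℝ V]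
    (γ : Fin m → StrongDual ℝ V) (K : Set (Finset (Fin m))) :
    coordComplement K → leafSpace γ K :=
  Quotient.mk (@AddAction.orbitRel V (coordComplement K) _ (expAction γ K))

/-! ### The quadratic map -/

/-- The map `μ_Γ : ℝ^m → V^*`, `x ↦ x_1² γ_1 + ⋯ + x_m² γ_m`. -/
def momentMap {m : ℕ} {V : Type*} [NormedAddCommGroup V] [NormedSpace ℝ V]
    (γ : Fin m → StrongDual ℝ V) (x : Fin m → ℝ) : StrongDual ℝ V :=
  ∑ i, (x i) ^ 2 • γ i

/-- `y` is a regular value of `f`: at each point of the fibre over `y`, `f` is differentiable with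
surjective differential. -/
def IsRegularValue {E F : Type*} [NormedAddCommGroup E] [NormedSpace ℝ E]
    [NormedAddCommGroup F] [NormedSpace ℝ F] (f : E → F) (y : F) : Prop :=
  ∀ x, f x = y → ∃ f' : E →L[ℝ] F, HasFDerivAt f f' x ∧ Function.Surjective f'

/-- The gradient of a function on `ℝ^m`: the vector of its partial derivatives. -/
def grad {m : ℕ} (f : (Fin m → ℝ) → ℝ) (x : Fin m → ℝ) : Fin m → ℝ :=
  fun i => fderiv ℝ f x (Pi.single i 1)

/-- `Z ⊆ ℝ^m` is the nondegenerate intersection of the quadrics `q_j = d_j`, `j ∈ κ`, where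
`q_j(x) = ∑_i c_{ji} x_i²`: it is the set of their common points, and the gradients of the `q_j`
are linearly independent at each of its points. -/
def IsNondegenerateIntersection {m : ℕ} {κ : Type*} (c : κ → Fin m → ℝ) (d : κ → ℝ)
    (Z : Set (Fin m → ℝ)) : Prop :=
  Z = {x | ∀ j, ∑ i, c j i * (x i) ^ 2 = d j} ∧
    ∀ x ∈ Z, LinearIndependent ℝ (fun j => grad (fun y => ∑ i, c j i * (y i) ^ 2) x)

/-! ### Smooth structures -/

/-- The smooth structure on `Z ⊆ ℝ^m` given by the charted space structure makes `Z` an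
`n`-dimensional embedded submanifold of `ℝ^m`: it is a smooth manifold structure on `Z` with its
subspace topology for which the inclusion is a smooth immersion (hence a smooth embedding). -/
def IsSubmanifoldStructure {m : ℕ} (n : ℕ) (Z : Set (Fin m → ℝ))
    [ChartedSpace (EuclideanSpace ℝ (Fin n)) Z] : Prop :=
  IsManifold (𝓡 n) ∞ Z ∧
    ContMDiff (𝓡 n) 𝓘(ℝ, Fin m → ℝ) ∞ (Subtype.val : Z → Fin m → ℝ) ∧
    ∀ x : Z, Function.Injective
      (mfderiv (𝓡 n) 𝓘(ℝ, Fin m → ℝ) (Subtype.val : Z → Fin m → ℝ) x)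

/-- The smooth structure on `U(K)/V` given by the charted space structure is the quotient one: it is
an `n`-dimensional smooth manifold structure on `U(K)/V` with its quotient topology for which
the quotient map is a smooth submersion. -/
def IsQuotientStructure {m : ℕ} (n : ℕ) {V : Type*} [NormedAddCommGroup V] [NormedSpace ℝ V]
    (γ : Fin m → StrongDual ℝ V) (K : Set (Finset (Fin m)))
    [ChartedSpace (EuclideanSpace ℝ (Fin n)) (leafSpace γ K)] : Prop :=
  IsManifold (𝓡 n) ∞ (leafSpace γ K) ∧
    ContMDiff 𝓘(ℝ, Fin m → ℝ) (𝓡 n) ∞ (leafMap γ K) ∧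
    ∀ x : coordComplement K, Function.Surjective
      (mfderiv 𝓘(ℝ, Fin m → ℝ) (𝓡 n) (leafMap γ K) x)

end GaleQuadrics

end

open GaleQuadrics

open Set Topology Filter GaleQuadrics

/-! The key fact is that every `V`-orbit in `U(K_P)` meets the level set over `δ` exactly once. For
`x` in `U(K_P)` the zero set of `x` is a face of `K_P`, so some `w ∈ P` has slacks `c i = a i w + b
i ≥ 0` vanishing wherever `x` does. Gale duality gives `∑ c i • γ i = δ`, and genericity of `P`
becomes the statement that the `γ i` with `c i ≠ 0` separate `V` (`IsGaleDual.supportSeparates`).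
Hence `∑ (x i ^ 2 / 2 * exp (2 * γ i v) - c i * γ i v)` is coercive in `v`, and its critical points
are exactly the `v` moving `x` into the level set (`exists_momentMap_expAct_eq`); monotonicity of
`exp` makes that `v` unique. The implicit function theorem makes this `v = u x` smooth in `x`. The
rule `u (v · x) = u x - v` then gives properness and a homeomorphism from the orbit space to the
level set. Separation also yields interiority of `δ`, regularity, nondegeneracy and freeness. -/

/-- A chart on a subset `Z` of a normed space is linear if it is the restriction of a continuous
linear map and its inverse, seen as a map to the ambient space, is smooth. -/
def IsLinearChart {E N : Type*} [NormedAddCommGroup E] [NormedSpace ℝ E]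
    [NormedAddCommGroup N] [NormedSpace ℝ N] {Z : Set E} (e : OpenPartialHomeomorph Z N) : Prop :=
  (∃ p : E →L[ℝ] N, ∀ z : Z, e z = p z) ∧ ContDiffOn ℝ ∞ (fun y => (e.symm y : E)) e.target

/-! ### Submanifold structures whose charts are restricted linear maps. -/

section LinearAtlas

variable {E N : Type*} [NormedAddCommGroup E] [NormedSpace ℝ E]
  [NormedAddCommGroup N] [NormedSpace ℝ N] {Z : Set E} [ChartedSpace N Z]

theorem isManifold_of_isLinearChart (h : ∀ e ∈ atlas N Z, IsLinearChart e) :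
    IsManifold 𝓘(ℝ, N) ∞ Z := by
  refine isManifold_of_contDiffOn _ _ _ fun e e' he he' => ?_
  obtain ⟨p, hp⟩ := (h e' he').1
  have : ContDiffOn ℝ ∞ (fun y => p (e.symm y : E)) e.target :=
    p.contDiff.comp_contDiffOn (h e he).2
  refine (this.mono ?_).congr ?_
  · intro y hy
    simp only [mfld_simps] at hy
    exact hy.1
  · intro y _
    simp [hp]

theorem contMDiff_subtype_val_of_isLinearChart (h : ∀ e ∈ atlas N Z, IsLinearChart e) :
    ContMDiff 𝓘(ℝ, N) 𝓘(ℝ, E) ∞ (Subtype.val : Z → E) := by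
  intro z
  rw [contMDiffAt_iff]
  refine ⟨continuous_subtype_val.continuousAt, ?_⟩
  have hz := (h _ (chart_mem_atlas N z)).2
  have := hz.contDiffAt ((chartAt N z).open_target.mem_nhds (mem_chart_target N z))
  exact this.contDiffWithinAt

theorem contMDiff_of_subtype_val_comp (h : ∀ e ∈ atlas N Z, IsLinearChart e)
    {E' H' M : Type*} [NormedAddCommGroup E'] [NormedSpace ℝ E'] [TopologicalSpace H']
    {I : ModelWithCorners ℝ E' H'} [TopologicalSpace M] [ChartedSpace H' M] {g : M → Z}
    (hg : ContMDiff I 𝓘(ℝ, E) ∞ (fun x => (g x : E))) : ContMDiff I 𝓘(ℝ, N) ∞ g := by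
  intro x
  rw [contMDiffAt_iff_target]
  refine ⟨(continuous_induced_rng.2 hg.continuous).continuousAt, ?_⟩
  obtain ⟨p, hp⟩ := (h _ (chart_mem_atlas N (g x))).1
  have : (extChartAt 𝓘(ℝ, N) (g x) ∘ g) = fun y => p (g y : E) := by
    funext y
    simp [hp]
  rw [this]
  exact (p.contDiff.contMDiff.comp hg) x

/-- The chart at `z` factors through the inclusion as `p ∘ Subtype.val`, and its differential is
invertible. -/
theorem injective_mfderiv_subtype_val (h : ∀ e ∈ atlas N Z, IsLinearChart e) (z : Z) :
    Function.Injective (mfderiv 𝓘(ℝ, N) 𝓘(ℝ, E) (Subtype.val : Z → E) z) := by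
  have := isManifold_of_isLinearChart h
  have hval := contMDiff_subtype_val_of_isLinearChart h
  obtain ⟨p, hp⟩ := (h _ (chart_mem_atlas N z)).1
  have hcomp : (extChartAt 𝓘(ℝ, N) z : Z → N) = p ∘ (Subtype.val : Z → E) := by
    funext y
    simp [hp]
  have h1 : MDifferentiableAt 𝓘(ℝ, E) 𝓘(ℝ, N) p (z : E) :=
    (p.contDiff (n := ∞)).contMDiff.mdifferentiableAt (by simp)
  have h2 : MDifferentiableAt 𝓘(ℝ, N) 𝓘(ℝ, E) (Subtype.val : Z → E) z :=
    hval.mdifferentiableAt (by simp)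
  have hd := mfderiv_comp z h1 h2
  rw [← hcomp] at hd
  have hinj : Function.Injective (mfderiv 𝓘(ℝ, N) 𝓘(ℝ, N) (extChartAt 𝓘(ℝ, N) z) z) :=
    (isInvertible_mfderiv_extChartAt (I := 𝓘(ℝ, N)) (mem_extChartAt_source z)).injective
  rw [hd] at hinj
  exact Function.Injective.of_comp hinj

end LinearAtlas

/-! ### Regular level sets as submanifolds. -/

section LevelSet

variable {E F N : Type*} [NormedAddCommGroup E] [NormedSpace ℝ E] [FiniteDimensional ℝ E]
  [NormedAddCommGroup F] [NormedSpace ℝ F] [FiniteDimensional ℝ F]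
  [NormedAddCommGroup N] [NormedSpace ℝ N] [FiniteDimensional ℝ N]

/-- `p` is a linear retraction onto `ker f'`, followed by an identification of the kernel with `N`
by dimension. -/
theorem exists_equiv_prod_of_surjective (f' : E →L[ℝ] F) (hf' : Function.Surjective f')
    (hdim : Module.finrank ℝ E = Module.finrank ℝ F + Module.finrank ℝ N) :
    ∃ (p : E →L[ℝ] N) (L : E ≃L[ℝ] F × N), (L : E →L[ℝ] F × N) = f'.prod p := by
  obtain ⟨g, hg⟩ := LinearMap.exists_leftInverse_of_injective
    (LinearMap.ker (f' : E →ₗ[ℝ] F)).subtype (Submodule.ker_subtype _)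
  have hker : Module.finrank ℝ (LinearMap.ker (f' : E →ₗ[ℝ] F)) = Module.finrank ℝ N := by
    have h1 := (f' : E →ₗ[ℝ] F).finrank_range_add_finrank_ker
    rw [LinearMap.range_eq_top.2 hf', finrank_top] at h1
    omega
  let i := LinearEquiv.ofFinrankEq _ _ hker
  let p : E →L[ℝ] N := LinearMap.toContinuousLinearMap (i.toLinearMap ∘ₗ g)
  have hinj : Function.Injective (f'.prod p : E →ₗ[ℝ] F × N) := by
    rw [← LinearMap.ker_eq_bot, LinearMap.ker_eq_bot']
    intro x hx
    have hx1 : f' x = 0 := congrArg Prod.fst hx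
    have hx2 : i (g x) = 0 := congrArg Prod.snd hx
    have hx3 : g x = 0 := by simpa using hx2
    have := LinearMap.congr_fun hg ⟨x, hx1⟩
    simp only [LinearMap.comp_apply, Submodule.subtype_apply, LinearMap.id_apply] at this
    rw [hx3] at this
    exact (congrArg Subtype.val this).symm
  refine ⟨p, (LinearMap.linearEquivOfInjective _ hinj
    (by rw [Module.finrank_prod, hdim])).toContinuousLinearEquiv, ?_⟩
  ext x <;> rfl

/-- By the inverse function theorem `(f, p)` is a local diffeomorphism at `z`; on the fibre its
first component is constant, so `p` alone is a chart. -/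
theorem exists_isLinearChart_levelSet {f : E → F} (hf : ContDiff ℝ ∞ f) {y : F} (z : f ⁻¹' {y})
    {f' : E →L[ℝ] F} (hd : HasFDerivAt f f' z) (hf' : Function.Surjective f')
    (hdim : Module.finrank ℝ E = Module.finrank ℝ F + Module.finrank ℝ N) :
    ∃ e : OpenPartialHomeomorph (f ⁻¹' {y}) N, z ∈ e.source ∧ IsLinearChart e := by
  obtain ⟨p, L, hL⟩ := exists_equiv_prod_of_surjective f' hf' hdim
  have hΦ : ContDiff ℝ ∞ (fun x => (f x, p x)) := hf.prodMk p.contDiff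
  have hΦ' : HasFDerivAt (fun x => (f x, p x)) (L : E →L[ℝ] F × N) z :=
    hL ▸ hd.prodMk p.hasFDerivAt
  let S : Set E := {x | fderiv ℝ (fun x => (f x, p x)) x ∈
    range ((↑) : (E ≃L[ℝ] F × N) → E →L[ℝ] F × N)}
  have hS : IsOpen S :=
    (ContinuousLinearEquiv.isOpen).preimage (hΦ.continuous_fderiv (by simp))
  -- Restricting to points with invertible derivative makes the inverse smooth on the whole target,
  -- not only near the image of `z`.
  let Φ := (hΦ.contDiffAt.toOpenPartialHomeomorph _ hΦ' (by simp)).restrOpen S hS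
  have hΦcoe : ∀ x, Φ x = (f x, p x) := fun x => rfl
  have hzΦ : (z : E) ∈ Φ.source :=
    ⟨hΦ.contDiffAt.mem_toOpenPartialHomeomorph_source hΦ' (by simp), L, hΦ'.fderiv.symm⟩
  have hsymm : ContDiffOn ℝ ∞ Φ.symm Φ.target := by
    intro w hw
    obtain ⟨L', hL'⟩ := (Φ.map_target hw).2
    refine (Φ.contDiffAt_symm (f₀' := L') hw ?_ hΦ.contDiffAt).contDiffWithinAt
    rw [hL']
    exact (hΦ.differentiable (by simp) _).hasFDerivAt
  have hmem : ∀ w : N, (y, w) ∈ Φ.target → Φ.symm (y, w) ∈ f ⁻¹' {y} := fun w hw => by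
    have := Φ.right_inv hw
    rw [hΦcoe] at this
    exact congrArg Prod.fst this
  have hpair : ∀ x : f ⁻¹' {y}, Φ x = (y, p x) := fun x => by
    rw [hΦcoe]
    exact congrArg (·, p x) x.2
  classical
  let e : OpenPartialHomeomorph (f ⁻¹' {y}) N :=
    { toFun := fun x => p x
      invFun := fun w => if hw : (y, w) ∈ Φ.target then ⟨Φ.symm (y, w), hmem w hw⟩ else z
      source := {x | (x : E) ∈ Φ.source}
      target := {w | (y, w) ∈ Φ.target}
      map_source' := fun x hx => by
        have := Φ.map_source hx
        rwa [hpair] at this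
      map_target' := fun w hw => by
        have hw' : (y, w) ∈ Φ.target := hw
        simp only [hw', dif_pos]
        exact Φ.map_target hw'
      left_inv' := fun x hx => by
        have h1 := Φ.map_source hx
        have h2 := Φ.left_inv hx
        rw [hpair] at h1 h2
        simp only [h1, dif_pos]
        exact Subtype.ext h2
      right_inv' := fun w hw => by
        have hw' : (y, w) ∈ Φ.target := hw
        simp only [hw', dif_pos]
        have := Φ.right_inv hw'
        rw [hΦcoe] at this
        exact congrArg Prod.snd this
      open_source := Φ.open_source.preimage continuous_subtype_val
      open_target := Φ.open_target.preimage (by fun_prop)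
      continuousOn_toFun := by fun_prop
      continuousOn_invFun := by
        rw [IsInducing.subtypeVal.continuousOn_iff]
        refine (Φ.continuousOn_symm.comp (t := Φ.target) (f := fun w => (y, w)) (by fun_prop)
          (fun w hw => hw)).congr fun w hw => ?_
        have hw' : (y, w) ∈ Φ.target := hw
        simp [hw'] }
  refine ⟨e, hzΦ, ⟨p, fun x => rfl⟩, ?_⟩
  refine (hsymm.comp (f := fun w => (y, w)) (by fun_prop) (fun w hw => hw)).congr fun w hw => ?_
  have hw' : (y, w) ∈ Φ.target := hw
  simp [e, hw']

theorem exists_chartedSpace_levelSet {f : E → F} (hf : ContDiff ℝ ∞ f) {y : F}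
    (hreg : GaleQuadrics.IsRegularValue f y)
    (hdim : Module.finrank ℝ E = Module.finrank ℝ F + Module.finrank ℝ N) :
    ∃ _ : ChartedSpace N (f ⁻¹' {y}), ∀ e ∈ atlas N (f ⁻¹' {y}), IsLinearChart e := by
  have (z : f ⁻¹' {y}) : ∃ e : OpenPartialHomeomorph (f ⁻¹' {y}) N,
      z ∈ e.source ∧ IsLinearChart e := by
    obtain ⟨f', hd, hs⟩ := hreg z z.2
    exact exists_isLinearChart_levelSet hf z hd hs hdim
  choose c hc hlin using this
  refine ⟨{ atlas := range c
            chartAt := c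
            mem_chart_source := hc
            chart_mem_atlas := fun z => mem_range_self z }, ?_⟩
  rintro _ ⟨z, rfl⟩
  exact hlin z

end LevelSet

/-! ### Transport of a smooth structure along a homeomorphism. -/

section Pullback

variable {H M M' : Type*} [TopologicalSpace H] [TopologicalSpace M] [TopologicalSpace M']

/-- The charted space structure obtained from one on the target of a homeomorphism. -/
@[reducible]
def Homeomorph.pullbackChartedSpace [ChartedSpace H M'] (h : M ≃ₜ M') : ChartedSpace H M where
  atlas := (fun e => h.toOpenPartialHomeomorph ≫ₕ e) '' atlas H M'
  chartAt x := h.toOpenPartialHomeomorph ≫ₕ chartAt H (h x)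
  mem_chart_source x := by simp
  chart_mem_atlas x := mem_image_of_mem _ (chart_mem_atlas H (h x))

variable {E : Type*} [NormedAddCommGroup E] [NormedSpace ℝ E] (I : ModelWithCorners ℝ E H)
  {n : ℕ∞ω}

theorem Homeomorph.isManifold_pullback [ChartedSpace H M'] [IsManifold I n M'] (h : M ≃ₜ M') :
    @IsManifold ℝ _ E _ _ H _ I n M _ h.pullbackChartedSpace := by
  let _ := h.pullbackChartedSpace (H := H)
  refine @IsManifold.mk ℝ _ E _ _ H _ I n M _ _ ⟨?_⟩
  rintro _ _ ⟨e, he, rfl⟩ ⟨e', he', rfl⟩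
  convert! (contDiffGroupoid n I).compatible he he' using 1
  ext <;> simp

theorem Homeomorph.contMDiff_pullback [ChartedSpace H M'] (h : M ≃ₜ M') :
    @ContMDiff ℝ _ E _ _ H _ I M _ h.pullbackChartedSpace E _ _ H _ I M' _ _ n h := by
  let _ := h.pullbackChartedSpace (H := H)
  intro x
  rw [contMDiffAt_iff]
  refine ⟨h.continuous.continuousAt, ?_⟩
  have := ((contMDiffAt_iff (I := I) (I' := I) (n := n)).1
    (contMDiffAt_id : ContMDiffAt I I n (id : M' → M') (h x))).2
  convert! this using 1
  funext y
  change extChartAt I (h x) (h (h.symm ((extChartAt I (h x)).symm y))) = _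
  rw [h.apply_symm_apply]
  rfl

theorem Homeomorph.contMDiff_symm_pullback [ChartedSpace H M'] (h : M ≃ₜ M') :
    @ContMDiff ℝ _ E _ _ H _ I M' _ _ E _ _ H _ I M _ h.pullbackChartedSpace n h.symm := by
  let _ := h.pullbackChartedSpace (H := H)
  intro x
  rw [contMDiffAt_iff]
  refine ⟨h.symm.continuous.continuousAt, ?_⟩
  have := ((contMDiffAt_iff (I := I) (I' := I) (n := n)).1
    (contMDiffAt_id : ContMDiffAt I I n (id : M' → M') x)).2
  convert! this using 1
  funext y
  change extChartAt I (h (h.symm x)) (h (h.symm ((extChartAt I x).symm y))) = _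
  rw [h.apply_symm_apply, h.apply_symm_apply]
  rfl

end Pullback

/-! ### Linear algebra of Gale duality. -/

section LinearAlgebra

variable {m : ℕ} {V W : Type*} [NormedAddCommGroup V] [NormedSpace ℝ V]
  [AddCommGroup W] [Module ℝ W]

theorem exists_forall_apply_eq_of_linearIndependent {ι : Type*} [Finite ι]
    {a : ι → Module.Dual ℝ W} (ha : LinearIndependent ℝ a) (t : ι → ℝ) :
    ∃ w : W, ∀ i, a i w = t i := by
  have h : LinearIndependent ℝ (fun i (w : W) => a i w) :=
    ha.map' (LinearMap.ltoFun ℝ W ℝ ℝ) (LinearMap.ker_eq_bot.2 DFunLike.coe_injective)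
  have hspan := span_flip_eq_top_iff_linearIndependent.2 h
  have hrange : Set.range (flip fun i (w : W) => a i w) = LinearMap.range (LinearMap.pi a) := rfl
  rw [hrange, Submodule.span_eq] at hspan
  obtain ⟨w, hw⟩ := LinearMap.range_eq_top.1 hspan t
  exact ⟨w, fun i => congrFun hw i⟩

/-- The vectors `γ_i` with `c_i ≠ 0` separate the points of `V`. -/
def SupportSeparates (γ : Fin m → StrongDual ℝ V) (c : Fin m → ℝ) : Prop :=
  ∀ v, (∀ i, c i ≠ 0 → γ i v = 0) → v = 0

theorem SupportSeparates.mono {γ : Fin m → StrongDual ℝ V} {c d : Fin m → ℝ}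
    (hc : SupportSeparates γ c) (h : ∀ i, d i = 0 → c i = 0) : SupportSeparates γ d :=
  fun v hv => hc v fun i hi => hv i fun hd => hi (h i hd)

theorem eq_zero_of_span_eq_top {γ : Fin m → StrongDual ℝ V}
    (h : Submodule.span ℝ (Set.range γ) = ⊤) {v : V} (hv : ∀ i, γ i v = 0) : v = 0 := by
  have hle : Submodule.span ℝ (Set.range γ) ≤
      LinearMap.ker (ContinuousLinearMap.apply ℝ ℝ v : StrongDual ℝ V →ₗ[ℝ] ℝ) := by
    rw [Submodule.span_le]
    rintro _ ⟨i, rfl⟩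
    exact hv i
  rw [h] at hle
  by_contra hne
  obtain ⟨f, -, hf⟩ := exists_dual_vector ℝ v (norm_ne_zero_iff.2 hne)
  have : f v = 0 := hle (Submodule.mem_top : f ∈ ⊤)
  rw [this] at hf
  exact hne (norm_eq_zero.1 (by simpa using hf.symm))

/-- Independence provides `w` with `a i w = γ i v` wherever `c i = 0`. Pairing the relation `∑ a i w
• γ i = 0` with `v` gives `∑ (γ i v) ^ 2 = 0`, since the other `γ i v` vanish. -/
theorem GaleQuadrics.IsGaleDual.supportSeparates {a : Fin m → Module.Dual ℝ W}
    {γ : Fin m → StrongDual ℝ V} (h : IsGaleDual a γ) {c : Fin m → ℝ}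
    (hc : LinearIndependent ℝ (fun i : {i : Fin m // c i = 0} => a i)) :
    SupportSeparates γ c := by
  intro v hv
  obtain ⟨w, hw⟩ := exists_forall_apply_eq_of_linearIndependent hc (fun i => γ i v)
  have h0 := (h.exact (fun i => a i w)).2 ⟨w, fun _ => rfl⟩
  have h1 : ∑ i, a i w * γ i v = 0 := by
    simpa using congrArg (fun φ : StrongDual ℝ V => φ v) h0
  have h2 : ∀ i, a i w * γ i v = γ i v * γ i v := fun i => by
    by_cases hi : c i = 0
    · rw [hw ⟨i, hi⟩]
    · rw [hv i hi, mul_zero, mul_zero]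
  simp only [h2] at h1
  have h3 := (Finset.sum_eq_zero_iff_of_nonneg fun i _ => mul_self_nonneg (γ i v)).1 h1
  exact eq_zero_of_span_eq_top h.span_right fun i => mul_self_eq_zero.1 (h3 i (Finset.mem_univ i))

theorem GaleQuadrics.IsGaleDual.finrank_eq [FiniteDimensional ℝ W]
    {a : Fin m → Module.Dual ℝ W}
    {γ : Fin m → StrongDual ℝ V} (h : IsGaleDual a γ) :
    Module.finrank ℝ (Fin m → ℝ) =
      Module.finrank ℝ (StrongDual ℝ V) + Module.finrank ℝ W := by
  let T : (Fin m → ℝ) →ₗ[ℝ] StrongDual ℝ V := Fintype.linearCombination ℝ γ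
  let A : W →ₗ[ℝ] (Fin m → ℝ) := LinearMap.pi a
  have hT : LinearMap.range T = ⊤ := by
    rw [Fintype.range_linearCombination, h.span_right]
  have hker : LinearMap.ker T = LinearMap.range A := by
    ext c
    rw [LinearMap.mem_ker, LinearMap.mem_range, Fintype.linearCombination_apply, h.exact c]
    exact ⟨fun ⟨w, hw⟩ => ⟨w, funext hw⟩, fun ⟨w, hw⟩ => ⟨w, fun i => congrFun hw i⟩⟩
  have hA : Function.Injective A := by
    rw [← LinearMap.ker_eq_bot, LinearMap.ker_eq_bot']
    intro w hw
    refine (Module.forall_dual_apply_eq_zero_iff ℝ w).1 fun φ => ?_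
    have hle : Submodule.span ℝ (Set.range a) ≤ LinearMap.ker (Module.Dual.eval ℝ W w) := by
      rw [Submodule.span_le]
      rintro _ ⟨i, rfl⟩
      exact congrFun hw i
    rw [h.span_left] at hle
    exact hle (Submodule.mem_top : φ ∈ ⊤)
  have h1 := T.finrank_range_add_finrank_ker
  rw [hT, finrank_top, hker, LinearMap.finrank_range_of_inj hA] at h1
  exact h1.symm

variable [FiniteDimensional ℝ V]

/-- The operator `V → V^*`, `v ↦ ∑ c_i ⟨γ_i, v⟩ γ_i`, as an equivalence. -/
theorem exists_equiv_of_supportSeparates {γ : Fin m → StrongDual ℝ V} {c : Fin m → ℝ}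
    (hc : ∀ i, 0 ≤ c i) (h : SupportSeparates γ c) :
    ∃ Q : V ≃L[ℝ] StrongDual ℝ V, ∀ v, Q v = ∑ i, (c i * γ i v) • γ i := by
  let T : V →ₗ[ℝ] StrongDual ℝ V := ∑ i, (c i • (γ i : V →ₗ[ℝ] ℝ)).smulRight (γ i)
  have hT : ∀ v, T v = ∑ i, (c i * γ i v) • γ i := fun v => by simp [T]
  have hinj : Function.Injective T := by
    rw [← LinearMap.ker_eq_bot, LinearMap.ker_eq_bot']
    intro v hv
    -- Pairing `T v` with `v` gives a nonnegative quadratic form, definite because the support of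
    -- `c` separates points.
    have h1 : ∑ i, c i * γ i v * γ i v = 0 := by
      have := congrArg (fun φ : StrongDual ℝ V => φ v) hv
      simpa [hT] using this
    have h2 := (Finset.sum_eq_zero_iff_of_nonneg fun i _ => by
      rw [mul_assoc]; exact mul_nonneg (hc i) (mul_self_nonneg (γ i v))).1 h1
    refine h v fun i hi => ?_
    simpa [hi] using h2 i (Finset.mem_univ i)
  have hdim : Module.finrank ℝ V = Module.finrank ℝ (StrongDual ℝ V) := by
    rw [← (LinearMap.toContinuousLinearMap (𝕜 := ℝ) (E := V) (F' := ℝ)).finrank_eq]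
    exact (Subspace.dual_finrank_eq).symm
  exact ⟨(LinearMap.linearEquivOfInjective T hinj hdim).toContinuousLinearEquiv, hT⟩

end LinearAlgebra

/-! ### The moment map: regularity, cones, quadrics. -/

section MomentMap

variable {m : ℕ} {V : Type*} [NormedAddCommGroup V] [NormedSpace ℝ V]

theorem contDiff_momentMap (γ : Fin m → StrongDual ℝ V) : ContDiff ℝ ∞ (momentMap γ) := by
  unfold momentMap
  fun_prop

theorem hasFDerivAt_momentMap (γ : Fin m → StrongDual ℝ V) (x : Fin m → ℝ) :
    HasFDerivAt (momentMap γ)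
      (∑ i, ((2 * x i) • (ContinuousLinearMap.proj i : (Fin m → ℝ) →L[ℝ] ℝ)).smulRight (γ i)) x := by
  unfold momentMap
  refine HasFDerivAt.fun_sum fun i _ => ?_
  have := ((ContinuousLinearMap.proj (R := ℝ) (φ := fun _ : Fin m => ℝ) i).hasFDerivAt
    (x := x)).pow 2
  have h2 := this.smul_const (γ i)
  simpa using h2

theorem surjective_fderiv_momentMap [FiniteDimensional ℝ V] {γ : Fin m → StrongDual ℝ V}
    {x : Fin m → ℝ} (hx : SupportSeparates γ x) :
    Function.Surjective ((∑ i, ((2 * x i) • (ContinuousLinearMap.proj i :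
      (Fin m → ℝ) →L[ℝ] ℝ)).smulRight (γ i) : (Fin m → ℝ) →L[ℝ] StrongDual ℝ V)) := by
  intro η
  obtain ⟨Q, hQ⟩ := exists_equiv_of_supportSeparates (c := fun i => x i ^ 2)
    (fun i => sq_nonneg _) (hx.mono fun i hi => by simpa using hi)
  -- The factor `2 * x i` of the differential turns this into the weights `x i ^ 2` of `Q`.
  refine ⟨fun i => x i * γ i (Q.symm η) / 2, ?_⟩
  conv_rhs => rw [← Q.apply_symm_apply η, hQ]
  rw [_root_.sum_apply]
  simp only [ContinuousLinearMap.smulRight_apply,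
    _root_.smul_apply, ContinuousLinearMap.proj_apply, smul_eq_mul]
  refine Finset.sum_congr rfl fun i _ => ?_
  congr 1
  ring

/-- A nearby `η` is obtained by multiplying each weight `c i` by `1 + γ i (Q⁻¹ (η - δ))`, which
stays positive; weights that are zero remain zero. -/
theorem mem_interior_dualCone [FiniteDimensional ℝ V] {γ : Fin m → StrongDual ℝ V}
    {c : Fin m → ℝ} (hc : ∀ i, 0 ≤ c i) (h : SupportSeparates γ c) {I : Finset (Fin m)}
    (hI : ∀ i ∈ I, c i = 0) : ∑ i, c i • γ i ∈ interior (dualCone γ I) := by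
  obtain ⟨Q, hQ⟩ := exists_equiv_of_supportSeparates hc h
  set δ := ∑ i, c i • γ i
  rw [mem_interior_iff_mem_nhds]
  have hev : ∀ᶠ η in 𝓝 δ, ∀ i, 0 < 1 + γ i (Q.symm (η - δ)) := by
    refine eventually_all.2 fun i => ?_
    have hcont : Continuous fun η => 1 + γ i (Q.symm (η - δ)) := by fun_prop
    exact hcont.continuousAt.eventually (lt_mem_nhds (by simp))
  filter_upwards [hev] with η hη
  have hη' : η = ∑ i, (c i * (1 + γ i (Q.symm (η - δ)))) • γ i := by
    have h1 := hQ (Q.symm (η - δ))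
    rw [Q.apply_symm_apply] at h1
    simp only [mul_add, mul_one, add_smul, Finset.sum_add_distrib, ← h1]
    simp [δ]
  rw [dualCone, SetLike.mem_coe, hη']
  refine sum_mem fun i _ => ?_
  by_cases hi : i ∈ I
  · simp [hI i hi]
  · exact Submodule.smul_mem _ (⟨_, mul_nonneg (hc i) (hη i).le⟩ : {r : ℝ // 0 ≤ r})
      (Submodule.subset_span ⟨i, hi, rfl⟩)

theorem isNondegenerateIntersection_momentMap {γ : Fin m → StrongDual ℝ V} {δ : StrongDual ℝ V}
    (hsep : ∀ x, momentMap γ x = δ → SupportSeparates γ x) {κ : Type*} [Fintype κ]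
    (e : Module.Basis κ ℝ V) :
    IsNondegenerateIntersection (fun j i => γ i (e j)) (fun j => δ (e j))
      (momentMap γ ⁻¹' {δ}) := by
  refine ⟨?_, fun x hx => ?_⟩
  · ext x
    simp only [mem_preimage, mem_singleton_iff, mem_ofPred_eq]
    have hval : ∀ v, momentMap γ x v = ∑ i, γ i v * x i ^ 2 := fun v => by
      simp [momentMap, mul_comm]
    simp only [← hval]
    refine ⟨fun h j => by rw [h], fun h => ?_⟩
    exact ContinuousLinearMap.coe_injective (e.ext h)
  · have hgrad : ∀ j, grad (fun y => ∑ i, γ i (e j) * y i ^ 2) x =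
        fun i => 2 * x i * γ i (e j) := fun j => by
      have hd : HasFDerivAt (fun y : Fin m → ℝ => ∑ i, γ i (e j) * y i ^ 2)
          (∑ i, (γ i (e j) * (2 * x i)) • (ContinuousLinearMap.proj i : (Fin m → ℝ) →L[ℝ] ℝ))
          x := by
        refine HasFDerivAt.fun_sum fun i _ => ?_
        have := (((ContinuousLinearMap.proj (R := ℝ) (φ := fun _ : Fin m => ℝ) i).hasFDerivAt
          (x := x)).pow 2).const_mul (γ i (e j))
        simpa [smul_smul] using this
      funext i
      rw [grad, hd.fderiv]
      simp [Pi.single_apply]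
      ring
    simp only [hgrad]
    rw [Fintype.linearIndependent_iff]
    intro t ht
    -- A relation `t` among the gradients says that `∑ t j • e j` is annihilated by each `γ i` with
    -- `x i ≠ 0`.
    have hv : ∑ j, t j • e j = 0 := by
      refine hsep x hx _ fun i hi => ?_
      have := congrFun ht i
      simp only [Finset.sum_apply, Pi.smul_apply, smul_eq_mul, Pi.zero_apply] at this
      have h2 : 2 * x i * γ i (∑ j, t j • e j) = 0 := by
        rw [← this, map_sum, Finset.mul_sum]
        refine Finset.sum_congr rfl fun j _ => ?_
        rw [map_smul, smul_eq_mul]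
        ring
      simpa [hi] using h2
    exact Fintype.linearIndependent_iff.1 e.linearIndependent t hv

end MomentMap

/-! ### From points of the polyhedron to weights. -/

section Polyhedron

variable {m : ℕ} {V W : Type*} [NormedAddCommGroup V] [NormedSpace ℝ V]
  [AddCommGroup W] [Module ℝ W] {a : Fin m → Module.Dual ℝ W} {b : Fin m → ℝ}
  {γ : Fin m → StrongDual ℝ V}

theorem mem_coordComplement {K : Set (Finset (Fin m))} {x : Fin m → ℝ} :
    x ∈ coordComplement K ↔ ∀ I : Finset (Fin m), (∀ i ∈ I, x i = 0) → I ∈ K := by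
  change x ∈ (⋃ I ∈ Kᶜ, {x : Fin m → ℝ | ∀ i ∈ I, x i = 0})ᶜ ↔ _
  simp only [mem_compl_iff, mem_iUnion, mem_ofPred_eq, not_exists, exists_prop, not_and]
  exact forall_congr' fun I => not_imp_not

theorem GaleQuadrics.IsGaleDual.sum_slack (hgale : IsGaleDual a γ) (w : W) :
    ∑ i, (a i w + b i) • γ i = ∑ i, b i • γ i := by
  have h0 := (hgale.exact (fun i => a i w)).2 ⟨w, fun _ => rfl⟩
  simp [add_smul, Finset.sum_add_distrib, h0]

theorem exists_weights_of_mem_dualComplex (hgale : IsGaleDual a γ)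
    (hgen : IsGenericPolyhedron a b) {I : Finset (Fin m)} (hI : I ∈ dualComplex a b) :
    ∃ c : Fin m → ℝ, (∀ i, 0 ≤ c i) ∧ (∀ i ∈ I, c i = 0) ∧ SupportSeparates γ c ∧
      ∑ i, c i • γ i = ∑ i, b i • γ i := by
  obtain ⟨w, hw, hwI⟩ := hI
  exact ⟨fun i => a i w + b i, hw, hwI, hgale.supportSeparates (hgen.2 w hw),
    hgale.sum_slack w⟩

theorem exists_weights_of_mem_coordComplement (hgale : IsGaleDual a γ)
    (hgen : IsGenericPolyhedron a b) {x : Fin m → ℝ} (hx : x ∈ coordComplement (dualComplex a b)) :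
    ∃ c : Fin m → ℝ, (∀ i, 0 ≤ c i) ∧ (∀ i, x i = 0 → c i = 0) ∧ SupportSeparates γ c ∧
      ∑ i, c i • γ i = ∑ i, b i • γ i := by
  have hI := mem_coordComplement.1 hx (Finset.univ.filter fun i => x i = 0) (by simp)
  simpa using exists_weights_of_mem_dualComplex hgale hgen hI

theorem supportSeparates_of_mem_coordComplement (hgale : IsGaleDual a γ)
    (hgen : IsGenericPolyhedron a b) {x : Fin m → ℝ} (hx : x ∈ coordComplement (dualComplex a b)) :
    SupportSeparates γ x := by
  obtain ⟨c, -, hc, hsep, -⟩ := exists_weights_of_mem_coordComplement hgale hgen hx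
  exact hsep.mono hc

/-- By exactness the squares `x i ^ 2` are the slacks of some `w ∈ P`, which lies on each hyperplane
with `x i = 0`. -/
theorem mem_coordComplement_of_momentMap_eq (hgale : IsGaleDual a γ) {x : Fin m → ℝ}
    (hx : momentMap γ x = ∑ i, b i • γ i) : x ∈ coordComplement (dualComplex a b) := by
  have h0 : ∑ i, (x i ^ 2 - b i) • γ i = 0 := by
    rw [Finset.sum_congr rfl fun i _ => sub_smul (x i ^ 2) (b i) (γ i), Finset.sum_sub_distrib]
    exact sub_eq_zero.2 hx
  obtain ⟨w, hw⟩ := (hgale.exact _).1 h0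
  refine mem_coordComplement.2 fun I hI => ⟨w, fun i => ?_, fun i hi => ?_⟩
  · rw [hw, sub_add_cancel]
    exact sq_nonneg _
  · rw [hw, sub_add_cancel, hI i hi, zero_pow two_ne_zero]

end Polyhedron

/-! ### Each orbit meets the level set once, smoothly. -/

section ExpAct

variable {m : ℕ} {V : Type*} [NormedAddCommGroup V] [NormedSpace ℝ V]
  {γ : Fin m → StrongDual ℝ V}

theorem expAct_add (v w : V) (x : Fin m → ℝ) :
    expAct γ (v + w) x = expAct γ v (expAct γ w x) := by
  funext i
  change x i * Real.exp (γ i (v + w)) = x i * Real.exp (γ i w) * Real.exp (γ i v)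
  rw [map_add, add_comm, Real.exp_add, mul_assoc]

theorem expAct_zero (x : Fin m → ℝ) : expAct γ 0 x = x := by
  funext i
  simp [expAct]

theorem contDiff_expAct (γ : Fin m → StrongDual ℝ V) :
    ContDiff ℝ ∞ (fun q : (Fin m → ℝ) × V => expAct γ q.2 q.1) := by
  unfold expAct
  fun_prop

theorem eq_zero_of_expAct_eq_self {x : Fin m → ℝ} (hx : SupportSeparates γ x) {v : V}
    (h : expAct γ v x = x) : v = 0 := by
  refine hx v fun i hi => ?_
  have h1 : x i * Real.exp (γ i v) = x i := congrFun h i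
  exact Real.exp_eq_one_iff _ |>.1 (mul_left_cancel₀ hi (by rw [h1, mul_one]))

/-- Evaluating the difference of the two values at `v - w` gives a sum of terms that are nonnegative
because `exp` is increasing; each must vanish. -/
theorem eq_of_momentMap_expAct_eq {x : Fin m → ℝ} (hx : SupportSeparates γ x) {v w : V}
    (h : momentMap γ (expAct γ v x) = momentMap γ (expAct γ w x)) : v = w := by
  have hval : ∀ y u, momentMap γ y u = ∑ i, y i ^ 2 * γ i u := fun y u => by simp [momentMap]
  have hterm : ∀ i, 0 ≤ (expAct γ v x i ^ 2 - expAct γ w x i ^ 2) * γ i (v - w) := fun i => by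
    simp only [expAct, mul_pow, ← mul_sub, map_sub]
    rcases le_total (γ i v) (γ i w) with hle | hle
    · refine mul_nonneg_of_nonpos_of_nonpos
        (mul_nonpos_of_nonneg_of_nonpos (sq_nonneg _) (sub_nonpos.2 ?_)) (sub_nonpos.2 hle)
      gcongr
    · refine mul_nonneg (mul_nonneg (sq_nonneg _) (sub_nonneg.2 ?_)) (sub_nonneg.2 hle)
      gcongr
  have hsum : ∑ i, (expAct γ v x i ^ 2 - expAct γ w x i ^ 2) * γ i (v - w) = 0 := by
    simp only [sub_mul, Finset.sum_sub_distrib, ← hval, h, sub_self]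
  have hzero := (Finset.sum_eq_zero_iff_of_nonneg fun i _ => hterm i).1 hsum
  rw [← sub_eq_zero]
  refine hx _ fun i hi => ?_
  rcases mul_eq_zero.1 (hzero i (Finset.mem_univ i)) with h0 | h0
  · rw [sub_eq_zero, sq_eq_sq_iff_abs_eq_abs] at h0
    simp only [expAct, abs_mul, Real.abs_exp] at h0
    have := Real.exp_injective (mul_left_cancel₀ (abs_ne_zero.2 hi) h0)
    rw [map_sub, this, sub_self]
  · exact h0

/-- Termwise coercivity bound. For `t ≥ 0` it combines `exp (2 * t) ≥ 2 * t ^ 2` with the square of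
`x * t - c / x`; for `t ≤ 0` the linear term suffices. At `x = 0` the convention `c / 0 = 0` is
harmless, as `c = 0`. -/
theorem sub_const_le_half_sq_mul_exp {x c : ℝ} (hxc : x = 0 → c = 0) (t : ℝ) :
    c * |t| - (c / x) ^ 2 ≤ x ^ 2 / 2 * Real.exp (2 * t) - c * t := by
  by_cases hx : x = 0
  · simp [hxc hx, hx]
  rcases le_total t 0 with ht | ht
  · rw [abs_of_nonpos ht]
    have h1 : 0 ≤ x ^ 2 / 2 * Real.exp (2 * t) := by positivity
    have h2 : 0 ≤ (c / x) ^ 2 := sq_nonneg _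
    linarith
  · rw [abs_of_nonneg ht]
    have h1 := Real.quadratic_le_exp_of_nonneg (mul_nonneg zero_le_two ht)
    have h2 : x ^ 2 / 2 * (2 * t ^ 2) ≤ x ^ 2 / 2 * Real.exp (2 * t) := by
      gcongr
      nlinarith
    have h3 : 0 ≤ (x * t - c / x) ^ 2 := sq_nonneg _
    have h4 : x * (c / x) = c := mul_div_cancel₀ c hx
    have h5 : (x * t - c / x) ^ 2 = x ^ 2 * t ^ 2 - 2 * (x * (c / x)) * t + (c / x) ^ 2 := by ring
    rw [h5, h4] at h3
    linarith

variable [FiniteDimensional ℝ V]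

/-- A positive combination of the `γ_i` is attained by the moment map on each orbit whose points
have sufficiently many nonzero coordinates: the moment map along the orbit is the differential of
a coercive convex function. -/
theorem exists_momentMap_expAct_eq {x c : Fin m → ℝ} (hc : ∀ i, 0 ≤ c i)
    (hxc : ∀ i, x i = 0 → c i = 0) (hsep : SupportSeparates γ c) :
    ∃ v, momentMap γ (expAct γ v x) = ∑ i, c i • γ i := by
  let f : V → ℝ := fun v => ∑ i, (x i ^ 2 / 2 * Real.exp (2 * γ i v) - c i * γ i v)
  let T : V →ₗ[ℝ] (Fin m → ℝ) := LinearMap.pi fun i => c i • (γ i : V →ₗ[ℝ] ℝ)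
  have hT : LinearMap.ker T = ⊥ := by
    rw [LinearMap.ker_eq_bot']
    intro v hv
    refine hsep v fun i hi => ?_
    have : c i * γ i v = 0 := congrFun hv i
    exact (mul_eq_zero.1 this).resolve_left hi
  -- `T` is injective by separation, so `‖T v‖` is proper; up to a constant it bounds `f` from
  -- below.
  have hTlim : Tendsto (fun v => ‖T v‖ + -∑ i, (c i / x i) ^ 2) (cocompact V) atTop :=
    tendsto_atTop_add_const_right _ _ ((tendsto_norm_cocompact_atTop (E := Fin m → ℝ)).comp
      (LinearMap.isClosedEmbedding_of_injective hT).tendsto_cocompact)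
  have hlim : Tendsto f (cocompact V) atTop := by
    refine tendsto_atTop_mono (fun v => ?_) hTlim
    have h1 : ‖T v‖ ≤ ∑ i, c i * |γ i v| := by
      have hnn : ∀ i ∈ Finset.univ, 0 ≤ c i * |γ i v| := fun i _ =>
        mul_nonneg (hc i) (abs_nonneg _)
      refine (pi_norm_le_iff_of_nonneg (Finset.sum_nonneg hnn)).2 fun i => ?_
      have : ‖T v i‖ = c i * |γ i v| := by
        change |c i * γ i v| = _
        rw [abs_mul, abs_of_nonneg (hc i)]
      rw [this]
      exact Finset.single_le_sum hnn (Finset.mem_univ i)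
    have h2 : ∑ i, (c i * |γ i v| - (c i / x i) ^ 2) ≤ f v :=
      Finset.sum_le_sum fun i _ => sub_const_le_half_sq_mul_exp (hxc i) _
    rw [Finset.sum_sub_distrib] at h2
    linarith
  have hcont : Continuous f := by fun_prop
  obtain ⟨v, hv⟩ := hcont.exists_forall_le hlim
  have hd : HasFDerivAt f (∑ i, (expAct γ v x i ^ 2 - c i) • γ i) v := by
    refine HasFDerivAt.fun_sum fun i _ => ?_
    have h1 := (γ i).hasFDerivAt (x := v)
    have h2 := ((h1.const_mul 2).exp.const_mul (x i ^ 2 / 2)).sub (h1.const_mul (c i))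
    convert! h2 using 1
    ext w
    change (expAct γ v x i ^ 2 - c i) * γ i w =
      x i ^ 2 / 2 * (Real.exp (2 * γ i v) * (2 * γ i w)) - c i * γ i w
    rw [expAct, mul_pow, ← Real.exp_nat_mul]
    push_cast
    ring
  have h0 := IsLocalMin.hasFDerivAt_eq_zero (Eventually.of_forall hv) hd
  rw [Finset.sum_congr rfl fun i _ => sub_smul (expAct γ v x i ^ 2) (c i) (γ i),
    Finset.sum_sub_distrib, sub_eq_zero] at h0
  exact ⟨v, h0⟩

theorem isInvertible_fderiv_momentMap_expAct {x : Fin m → ℝ} (hx : SupportSeparates γ x) (v : V) :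
    (fderiv ℝ (fun q : (Fin m → ℝ) × V => momentMap γ (expAct γ q.2 q.1)) (x, v) ∘L
      .inr ℝ (Fin m → ℝ) V).IsInvertible := by
  have hdiff : DifferentiableAt ℝ (fun q : (Fin m → ℝ) × V => momentMap γ (expAct γ q.2 q.1))
      (x, v) := ((contDiff_momentMap γ).comp (contDiff_expAct γ)).differentiable (by simp) _
  have h1 := HasFDerivAt.comp v hdiff.hasFDerivAt
    (hasFDerivAt_prodMk_right (𝕜 := ℝ) x v)
  obtain ⟨Q, hQ⟩ := exists_equiv_of_supportSeparates (c := fun i => 2 * expAct γ v x i ^ 2)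
    (fun i => by positivity) (hx.mono fun i hi => by simpa [expAct] using hi)
  have h2 : HasFDerivAt (fun w => momentMap γ (expAct γ w x)) (Q : V →L[ℝ] StrongDual ℝ V) v := by
    have : (Q : V →L[ℝ] StrongDual ℝ V) =
        ∑ i, ((2 * expAct γ v x i ^ 2) • γ i).smulRight (γ i) := by
      ext1 w
      rw [_root_.sum_apply]
      exact hQ w
    rw [this]
    unfold momentMap
    refine HasFDerivAt.fun_sum fun i _ => ?_
    have := ((((γ i).hasFDerivAt (x := v)).exp.const_mul (x i)).pow 2).smul_const (γ i)
    convert! this using 2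
    rw [smul_smul, smul_smul]
    congr 1
    simp only [expAct]
    ring
  exact ⟨Q, h2.unique h1⟩

/-- The moment map takes the value `δ` at exactly one point of each orbit in `U`, and this point
depends smoothly on the orbit. -/
theorem exists_contDiffOn_momentMap_expAct {U : Set (Fin m → ℝ)} (hU : IsOpen U)
    {δ : StrongDual ℝ V}
    (h : ∀ x ∈ U, ∃ c : Fin m → ℝ, (∀ i, 0 ≤ c i) ∧ (∀ i, x i = 0 → c i = 0) ∧
      SupportSeparates γ c ∧ ∑ i, c i • γ i = δ) :
    ∃ u : (Fin m → ℝ) → V, ContDiffOn ℝ ∞ u U ∧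
      ∀ x ∈ U, ∀ v, momentMap γ (expAct γ v x) = δ ↔ v = u x := by
  have hsep : ∀ x ∈ U, SupportSeparates γ x := fun x hx => by
    obtain ⟨c, -, hc, hs, -⟩ := h x hx
    exact hs.mono hc
  have hex : ∀ x ∈ U, ∃ v, momentMap γ (expAct γ v x) = δ := fun x hx => by
    obtain ⟨c, hc, hxc, hs, rfl⟩ := h x hx
    exact exists_momentMap_expAct_eq hc hxc hs
  classical
  let u : (Fin m → ℝ) → V := fun x => if hx : x ∈ U then (hex x hx).choose else 0
  have hu : ∀ x ∈ U, momentMap γ (expAct γ (u x) x) = δ := fun x hx => by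
    simp only [u, hx, dif_pos]
    exact (hex x hx).choose_spec
  have huniq : ∀ x ∈ U, ∀ v, momentMap γ (expAct γ v x) = δ ↔ v = u x := fun x hx v =>
    ⟨fun hv => eq_of_momentMap_expAct_eq (hsep x hx) (hv.trans (hu x hx).symm),
      fun hv => hv ▸ hu x hx⟩
  refine ⟨u, fun x hx => ContDiffAt.contDiffWithinAt ?_, huniq⟩
  have hF : ContDiffAt ℝ ∞ (fun q : (Fin m → ℝ) × V => momentMap γ (expAct γ q.2 q.1)) (x, u x) :=
    ((contDiff_momentMap γ).comp (contDiff_expAct γ)).contDiffAt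
  have hinv := isInvertible_fderiv_momentMap_expAct (hsep x hx) (u x)
  -- Uniqueness on each orbit forces `u` to agree locally with the implicit function.
  refine (hF.contDiffAt_implicitFunction (by simp) hinv).congr_of_eventuallyEq ?_
  filter_upwards [hF.eventually_apply_implicitFunction (by simp) hinv, hU.mem_nhds hx] with y hy hyU
  exact ((huniq y hyU _).1 (hy.trans (hu x hx))).symm

end ExpAct

/-! ### The orbit space and the diffeomorphism. -/

/-- `u` assigns to each `x ∈ U(K)` the only `v` that moves `x` into the level set over `δ`. -/
structure IsLevelShift {m : ℕ} {V : Type*} [NormedAddCommGroup V] [NormedSpace ℝ V]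
    (γ : Fin m → StrongDual ℝ V) (K : Set (Finset (Fin m))) (δ : StrongDual ℝ V)
    (u : (Fin m → ℝ) → V) : Prop where
  contDiffOn : ContDiffOn ℝ ∞ u (coordComplement K)
  momentMap_eq_iff : ∀ x ∈ coordComplement K, ∀ v, momentMap γ (expAct γ v x) = δ ↔ v = u x
  subset : momentMap γ ⁻¹' {δ} ⊆ coordComplement K

namespace IsLevelShift

variable {m : ℕ} {V : Type*} [NormedAddCommGroup V] [NormedSpace ℝ V]
  {γ : Fin m → StrongDual ℝ V} {K : Set (Finset (Fin m))} {δ : StrongDual ℝ V}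
  {u : (Fin m → ℝ) → V}

theorem expAct_eq (h : IsLevelShift γ K δ u) {x : Fin m → ℝ} (hx : x ∈ coordComplement K) (v : V) :
    u (expAct γ v x) = u x - v := by
  refine ((h.momentMap_eq_iff _ (expAct_mem γ K v x hx) _).1 ?_).symm
  rw [← expAct_add, sub_add_cancel]
  exact (h.momentMap_eq_iff x hx _).2 rfl

theorem eq_zero (h : IsLevelShift γ K δ u) {z : Fin m → ℝ} (hz : momentMap γ z = δ) : u z = 0 :=
  ((h.momentMap_eq_iff z (h.subset hz) 0).1 (by rw [expAct_zero, hz])).symm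

theorem continuous_restrict (h : IsLevelShift γ K δ u) :
    Continuous fun x : coordComplement K => u x :=
  continuousOn_iff_continuous_domRestrict.1 h.contDiffOn.continuousOn

theorem properVAdd (h : IsLevelShift γ K δ u) :
    @ProperVAdd V (coordComplement K) _ _ _ (expAction γ K) := by
  let _ := expAction γ K
  refine @ProperVAdd.mk _ _ _ _ _ (expAction γ K) (IsClosedEmbedding.isProperMap ?_)
  -- The group element is recovered continuously from `(v · x, x)` as `u x - u (v · x)`.
  refine Function.LeftInverse.isClosedEmbedding
    (f := fun q : coordComplement K × coordComplement K => (u q.2 - u q.1, q.2)) ?_ ?_ ?_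
  · rintro ⟨v, x⟩
    change (u x - u (expAct γ v x), x) = (v, x)
    rw [h.expAct_eq x.2, sub_sub_cancel]
  · exact ((h.continuous_restrict.comp continuous_snd).sub
      (h.continuous_restrict.comp continuous_fst)).prodMk continuous_snd
  · refine Continuous.prodMk (Continuous.subtype_mk ?_ _) continuous_snd
    exact (contDiff_expAct γ).continuous.comp
      ((continuous_subtype_val.comp continuous_snd).prodMk continuous_fst)

theorem leafMap_eq_iff {x y : coordComplement K} :
    leafMap γ K x = leafMap γ K y ↔ ∃ v, expAct γ v y = x := by
  refine Quotient.eq.trans ?_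
  exact exists_congr fun v => Subtype.ext_iff

theorem exists_homeomorph (h : IsLevelShift γ K δ u) :
    ∃ f : leafSpace γ K ≃ₜ (momentMap γ ⁻¹' {δ} : Set (Fin m → ℝ)),
      ∀ x : coordComplement K, (f (leafMap γ K x) : Fin m → ℝ) = expAct γ (u x) x := by
  let p : coordComplement K → (momentMap γ ⁻¹' {δ} : Set (Fin m → ℝ)) := fun x =>
    ⟨expAct γ (u x) x, (h.momentMap_eq_iff x x.2 _).2 rfl⟩
  have hp : Continuous p := Continuous.subtype_mk ((contDiff_expAct γ).continuous.comp
    (continuous_subtype_val.prodMk h.continuous_restrict)) _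
  have hlift : ∀ x y : coordComplement K,
      (@AddAction.orbitRel V (coordComplement K) _ (expAction γ K)) x y → p x = p y := by
    intro x y hxy
    obtain ⟨v, hv⟩ := leafMap_eq_iff.1 (Quotient.sound hxy : leafMap γ K x = leafMap γ K y)
    refine Subtype.ext ?_
    change expAct γ (u x) x = expAct γ (u y) y
    rw [← hv, h.expAct_eq y.2, ← expAct_add, sub_add_cancel]
  refine ⟨{ toFun := Quotient.lift p hlift
            invFun := fun z => leafMap γ K ⟨z, h.subset z.2⟩
            left_inv := ?_
            right_inv := fun z => Subtype.ext ?_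
            continuous_toFun := hp.quotient_lift hlift
            continuous_invFun := continuous_quotient_mk'.comp
              (continuous_subtype_val.subtype_mk _) }, fun x => rfl⟩
  · intro q
    induction q using Quotient.inductionOn with
    | h x => exact leafMap_eq_iff.2 ⟨u x, rfl⟩
  · change expAct γ (u z) z = z
    rw [h.eq_zero z.2, expAct_zero]

theorem isQuotientStructure (h : IsLevelShift γ K δ u) {n : ℕ}
    [ChartedSpace (EuclideanSpace ℝ (Fin n)) (momentMap γ ⁻¹' {δ} : Set (Fin m → ℝ))]
    (hlin : ∀ e ∈ atlas (EuclideanSpace ℝ (Fin n)) (momentMap γ ⁻¹' {δ} : Set (Fin m → ℝ)),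
      IsLinearChart e)
    {f : leafSpace γ K ≃ₜ (momentMap γ ⁻¹' {δ} : Set (Fin m → ℝ))}
    (hf : ∀ x : coordComplement K, (f (leafMap γ K x) : Fin m → ℝ) = expAct γ (u x) x) :
    @IsQuotientStructure m n V _ _ γ K f.pullbackChartedSpace := by
  let _ := f.pullbackChartedSpace (H := EuclideanSpace ℝ (Fin n))
  have := isManifold_of_isLinearChart hlin
  have hman : IsManifold (𝓡 n) ∞ (leafSpace γ K) := f.isManifold_pullback _
  have hsmooth : ContMDiff 𝓘(ℝ, Fin m → ℝ) (𝓡 n) ∞ (leafMap γ K) := by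
    have h1 : ContMDiff 𝓘(ℝ, Fin m → ℝ) 𝓘(ℝ, Fin m → ℝ) ∞
        (fun x : coordComplement K => (f (leafMap γ K x) : Fin m → ℝ)) := by
      simp only [hf]
      have h2 : ContDiffOn ℝ ∞ (fun x => expAct γ (u x) x) (coordComplement K) :=
        (contDiff_expAct γ).comp_contDiffOn (contDiffOn_id.prodMk h.contDiffOn)
      intro x
      exact contMDiffAt_subtype_iff.2 (h2.contMDiffOn.contMDiffAt
        ((coordComplement K).isOpen.mem_nhds x.2))
    have h3 := (f.contMDiff_symm_pullback (n := ∞) (𝓡 n)).comp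
      (contMDiff_of_subtype_val_comp hlin h1)
    simpa [Function.comp_def] using h3
  refine ⟨hman, hsmooth, fun x => ?_⟩
  -- A smooth section through `x` itself, not merely through its representative in the level set:
  -- shifting by `-u x` carries that representative back to `x`.
  let s : leafSpace γ K → coordComplement K := fun q =>
    ⟨expAct γ (-u x) (f q), expAct_mem γ K _ _ (h.subset (f q).2)⟩
  have hs : ContMDiff (𝓡 n) 𝓘(ℝ, Fin m → ℝ) ∞ s := by
    rw [← ContMDiff.subtypeVal_comp_iff]
    have h1 : ContDiff ℝ ∞ (expAct γ (-u x)) :=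
      (contDiff_expAct γ).comp (contDiff_id.prodMk contDiff_const)
    exact h1.contMDiff.comp ((contMDiff_subtype_val_of_isLinearChart hlin).comp
      (f.contMDiff_pullback (𝓡 n)))
  have hsx : s (leafMap γ K x) = x := by
    refine Subtype.ext ?_
    change expAct γ (-u x) (f (leafMap γ K x)) = x
    rw [hf, ← expAct_add, neg_add_cancel, expAct_zero]
  have hsec : leafMap γ K ∘ s = id := by
    funext q
    refine f.injective (Subtype.ext ?_)
    change (f (leafMap γ K (s q)) : Fin m → ℝ) = f q
    rw [hf]
    change expAct γ (u (expAct γ (-u x) (f q))) (expAct γ (-u x) (f q)) = f q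
    rw [h.expAct_eq (h.subset (f q).2), h.eq_zero (f q).2, ← expAct_add]
    simp [expAct_zero]
  have hd : mfderiv (𝓡 n) (𝓡 n) (leafMap γ K ∘ s) (leafMap γ K x) =
      (mfderiv 𝓘(ℝ, Fin m → ℝ) (𝓡 n) (leafMap γ K) (s (leafMap γ K x))).comp
        (mfderiv (𝓡 n) 𝓘(ℝ, Fin m → ℝ) s (leafMap γ K x)) :=
    mfderiv_comp _ (hsmooth.mdifferentiableAt (by simp)) (hs.mdifferentiableAt (by simp))
  have hsurj : Function.Surjective
      (mfderiv 𝓘(ℝ, Fin m → ℝ) (𝓡 n) (leafMap γ K) (s (leafMap γ K x))) := by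
    intro w
    refine ⟨mfderiv (𝓡 n) 𝓘(ℝ, Fin m → ℝ) s (leafMap γ K x) w, ?_⟩
    have hw := DFunLike.congr_fun hd w
    rw [hsec, mfderiv_id] at hw
    exact hw.symm
  rw [hsx] at hsurj
  exact hsurj

end IsLevelShift

theorem exists_isLevelShift {m : ℕ} {V W : Type*}
    [NormedAddCommGroup V] [NormedSpace ℝ V] [FiniteDimensional ℝ V]
    [AddCommGroup W] [Module ℝ W]
    {a : Fin m → Module.Dual ℝ W} {b : Fin m → ℝ} {γ : Fin m → StrongDual ℝ V}
    (hgale : IsGaleDual a γ) (hgen : IsGenericPolyhedron a b) :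
    ∃ u, IsLevelShift γ (dualComplex a b) (∑ i, b i • γ i) u := by
  obtain ⟨u, hu, huniq⟩ := exists_contDiffOn_momentMap_expAct (coordComplement _).isOpen
    fun x hx => exists_weights_of_mem_coordComplement hgale hgen hx
  exact ⟨u, hu, huniq, fun x hx => mem_coordComplement_of_momentMap_eq hgale hx⟩

theorem theorem8p4 {m : ℕ} {V W : Type*}
    [NormedAddCommGroup V] [NormedSpace ℝ V] [FiniteDimensional ℝ V]
    [AddCommGroup W] [Module ℝ W] [FiniteDimensional ℝ W]
    (a : Fin m → Module.Dual ℝ W) (b : Fin m → ℝ) (γ : Fin m → StrongDual ℝ V)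
    (hgale : IsGaleDual a γ) (hgen : IsGenericPolyhedron a b)
    (δ : StrongDual ℝ V) (hδ : δ = ∑ i, b i • γ i) :
    -- (1)
    δ ∈ ⋂ I ∈ dualComplex a b, intrinsicInterior ℝ (dualCone γ I) ∧
    -- (2)
    momentMap γ ⁻¹' {δ} ⊆ coordComplement (dualComplex a b) ∧
    -- (3)
    IsRegularValue (momentMap γ) δ ∧
    -- (4): the action is free and proper
    (∀ (v : V) (x : Fin m → ℝ), x ∈ coordComplement (dualComplex a b) →
      expAct γ v x = x → v = 0) ∧
    @ProperVAdd V (coordComplement (dualComplex a b)) _ _ _ (expAction γ (dualComplex a b)) ∧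
    -- in every basis of `V`, the level set is a nondegenerate intersection of `k = dim V` quadrics
    (∀ e : Module.Basis (Fin (Module.finrank ℝ V)) ℝ V,
      IsNondegenerateIntersection (fun j i => γ i (e j)) (fun j => δ (e j))
        (momentMap γ ⁻¹' {δ})) ∧
    -- the quotient manifold is diffeomorphic to the level set
    ∃ (_ : ChartedSpace (EuclideanSpace ℝ (Fin (Module.finrank ℝ W)))
          (leafSpace γ (dualComplex a b)))
      (_ : ChartedSpace (EuclideanSpace ℝ (Fin (Module.finrank ℝ W)))
          (momentMap γ ⁻¹' {δ} : Set (Fin m → ℝ))),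
      IsQuotientStructure (Module.finrank ℝ W) γ (dualComplex a b) ∧
      IsSubmanifoldStructure (Module.finrank ℝ W) (momentMap γ ⁻¹' {δ}) ∧
      Nonempty (Diffeomorph (𝓡 (Module.finrank ℝ W)) (𝓡 (Module.finrank ℝ W))
        (leafSpace γ (dualComplex a b)) (momentMap γ ⁻¹' {δ} : Set (Fin m → ℝ)) ∞) := by
  subst hδ
  obtain ⟨u, hu⟩ := exists_isLevelShift hgale hgen
  have hsep : ∀ x ∈ coordComplement (dualComplex a b), SupportSeparates γ x := fun x hx =>
    supportSeparates_of_mem_coordComplement hgale hgen hx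
  have hreg : IsRegularValue (momentMap γ) (∑ i, b i • γ i) := fun x hx =>
    ⟨_, hasFDerivAt_momentMap γ x, surjective_fderiv_momentMap (hsep x (hu.subset hx))⟩
  refine ⟨mem_iInter₂.2 fun I hI => ?_, hu.subset, hreg,
    fun v x hx h => eq_zero_of_expAct_eq_self (hsep x hx) h, hu.properVAdd,
    isNondegenerateIntersection_momentMap fun x hx => hsep x (hu.subset hx), ?_⟩
  · obtain ⟨c, hc, hcI, hs, hsum⟩ := exists_weights_of_mem_dualComplex hgale hgen hI
    rw [← hsum]
    exact interior_subset_intrinsicInterior (mem_interior_dualCone hc hs hcI)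
  · obtain ⟨_, hlin⟩ := exists_chartedSpace_levelSet
      (N := EuclideanSpace ℝ (Fin (Module.finrank ℝ W))) (contDiff_momentMap γ) hreg
      (by rw [hgale.finrank_eq, finrank_euclideanSpace_fin])
    obtain ⟨f, hf⟩ := hu.exists_homeomorph
    -- The orbit space receives its charts through `f`, so `f` is a diffeomorphism by construction;
    -- the content is that the quotient map is a submersion.
    refine ⟨f.pullbackChartedSpace, inferInstance, hu.isQuotientStructure hlin hf,
      ⟨isManifold_of_isLinearChart hlin, contMDiff_subtype_val_of_isLinearChart hlin,
        injective_mfderiv_subtype_val hlin⟩, ⟨?_⟩⟩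
    let _ := f.pullbackChartedSpace (H := EuclideanSpace ℝ (Fin (Module.finrank ℝ W)))
    exact { toEquiv := f.toEquiv
            contMDiff_toFun := f.contMDiff_pullback _
            contMDiff_invFun := f.contMDiff_symm_pullback _ }
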